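/- Let $p$ be an odd prime, $K/\mathbb{Q}_p$ a finite extension with ring of integers $\mathcal{O}_K$ and uniformizer $\pi$, and let $v_\pi$ be the $\pi$-adic valuation on $\mathcal{O}_K$. Fix an embedding $K\hookrightarrow\mathbb{C}$. Let $N\ge 1$, $k\ge 2$, $r\ge 1$ be integers and $\chi:(\mathbb{Z}/N\mathbb{Z})^\times\to\mathcal{O}_K^\times$ a character. Let $S_k(\Gamma_1(N),\chi,K)$ be the $K$-vector space of cusp forms of weight $k$, level $\Gamma_1(N)$ and character $\chi$ whose Fourier coefficients at $\infty$ lie in $K$, and let $\mathbb{T}_N$ be the $\mathcal{O}_K$-subalgebra of $\mathrm{End}_K(S_k(\Gamma_1(N),\chi,K))$ generated by the Hecke operators $T_n$, $n\ge 1$. Let $l$ be a prime not dividing $pN$, and assume that $\mathcal{O}_K$ contains an element $\zeta$ with $\zeta^2=\chi(l)$ and, if $k$ is odd, a square root $l^{1/2}$ of $l$; fix such elements. Let $S_l:=l^{k-2}\chi(l)$ and $R_l:=l^{(k-2)/2}\zeta$, regarded as scalar operators in $\mathbb{T}_N$ (so $R_l^2=S_l$). Let $f:\mathbb{T}_N\to\mathcal{O}_K/(\pi^r)$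 be a homomorphism of $\mathcal{O}_K$-algebras (a cuspidal eigenform modulo $\pi^r$), and for $0\le s\le r$ let $f_s:\mathbb{T}_N\to\mathcal{O}_K/(\pi^s)$ be its reduction. Say that $f$ satisfies $(\mathrm{LRC})^2$ if $T_l^2-(l+1)^2S_l\in\ker f$; that, for $\epsilon\in\{\pm1\}$, $f$ satisfies $(\mathrm{LRC})_\epsilon$ if $T_l-\epsilon(l+1)R_l\in\ker f$; and that $f$ satisfies $s$-$(\mathrm{LRC})_\epsilon$ if $T_l-\epsilon(l+1)R_l\in\ker f_s$ (an empty condition for $s=0$). Put $v:=v_\pi(l+1)$. If $f$ satisfies $(\mathrm{LRC})^2$, then there is $\epsilon\in\{\pm1\}$ such that $f$ satisfies $s$-$(\mathrm{LRC})_\epsilon$ with $s=\max(r-v,0)$. In particular, if $v=0$, then $f$ satisfies $(\mathrm{LRC})^2$ if and only if it satisfies $(\mathrm{LRC})_\epsilon$ for some $\epsilon\in\{\pm1\}$. -/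

import Mathlib

open scoped MatrixGroups ModularForm Manifold
open UpperHalfPlane CongruenceSubgroup

noncomputable section
namespace LevelRaising

/-- `f` is a cusp form of weight `k` for `Γ₁(N)` with nebentypus `ψ`. -/
def IsCuspFormWithChar (N k : ℕ) (ψ : DirichletCharacter ℂ N) (f : ℍ → ℂ) : Prop :=
  (∃ F : CuspForm ((Gamma1 N).map (Matrix.SpecialLinearGroup.mapGL ℝ)) (k : ℤ), ⇑F = f) ∧
    ∀ γ ∈ Gamma0 N, f ∣[(k : ℤ)] γ = ψ ((γ 1 1 : ℤ) : ZMod N) • f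

/-- An integral matrix of nonzero determinant, as an element of `GL₂(ℝ)`. -/
def intGL (M : Matrix (Fin 2) (Fin 2) ℤ) : GL (Fin 2) ℝ :=
  if h : (M.map (Int.cast : ℤ → ℝ)).det ≠ 0 then
    Matrix.GeneralLinearGroup.mkOfDetNeZero (M.map (Int.cast : ℤ → ℝ)) h else 1

lemma det_map_cast (M : Matrix (Fin 2) (Fin 2) ℤ) :
    (M.map (Int.cast : ℤ → ℝ)).det = (M.det : ℝ) := by
  simp [Matrix.det_fin_two]

lemma coe_intGL {M : Matrix (Fin 2) (Fin 2) ℤ} (h : M.det ≠ 0) :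
    (intGL M : Matrix (Fin 2) (Fin 2) ℝ) = M.map (Int.cast : ℤ → ℝ) := by
  have : (M.map (Int.cast : ℤ → ℝ)).det ≠ 0 := by rw [det_map_cast]; exact_mod_cast h
  simp [intGL, this, Matrix.GeneralLinearGroup.mkOfDetNeZero]

lemma intGL_mul_SL {M : Matrix (Fin 2) (Fin 2) ℤ} (h : M.det ≠ 0) (γ : SL(2, ℤ)) :
    intGL (M * (γ : Matrix (Fin 2) (Fin 2) ℤ)) =
      intGL M * Matrix.SpecialLinearGroup.mapGL ℝ γ := by
  have h' : (M * (γ : Matrix (Fin 2) (Fin 2) ℤ)).det ≠ 0 := by simpa using h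
  apply Units.ext
  rw [Units.val_mul, coe_intGL h, coe_intGL h']
  ext i j
  simp [Matrix.mul_apply]

lemma intGL_SL_mul {M : Matrix (Fin 2) (Fin 2) ℤ} (h : M.det ≠ 0) (γ : SL(2, ℤ)) :
    intGL ((γ : Matrix (Fin 2) (Fin 2) ℤ) * M) =
      Matrix.SpecialLinearGroup.mapGL ℝ γ * intGL M := by
  have h' : ((γ : Matrix (Fin 2) (Fin 2) ℤ) * M).det ≠ 0 := by simpa using h
  apply Units.ext
  rw [Units.val_mul, coe_intGL h, coe_intGL h']
  ext i j
  simp [Matrix.mul_apply]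

lemma det_intGL_pos {M : Matrix (Fin 2) (Fin 2) ℤ} (h : 0 < M.det) : 0 < (intGL M).det.val := by
  rw [Matrix.GeneralLinearGroup.val_det_apply, coe_intGL h.ne', det_map_cast]
  exact_mod_cast h

lemma smul_slash_intGL {M : Matrix (Fin 2) (Fin 2) ℤ} (h : 0 < M.det) (k : ℤ) (c : ℂ)
    (f : ℍ → ℂ) : (c • f) ∣[k] intGL M = c • (f ∣[k] intGL M) := by
  rw [ModularForm.smul_slash]
  have h' := det_intGL_pos h
  simp only [UpperHalfPlane.σ, if_pos h']
  rfl

lemma isCusp_intGL_smul {M : Matrix (Fin 2) (Fin 2) ℤ} (h : M.det ≠ 0) {c : OnePoint ℝ}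
    (hc : IsCusp c 𝒮ℒ) : IsCusp (intGL M • c) 𝒮ℒ := by
  have hq : (M.map (Int.cast : ℤ → ℚ)).det ≠ 0 := by
    have : (M.map (Int.cast : ℤ → ℚ)).det = (M.det : ℚ) := by simp [Matrix.det_fin_two]
    rw [this]; exact_mod_cast h
  obtain ⟨q, rfl⟩ := isCusp_SL2Z_iff.mp hc
  rw [isCusp_SL2Z_iff]
  have hg : intGL M = (Matrix.GeneralLinearGroup.mkOfDetNeZero _ hq).map (Rat.castHom ℝ) := by
    apply Units.ext
    rw [coe_intGL h]
    ext i j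
    simp [Matrix.GeneralLinearGroup.mkOfDetNeZero]
  refine ⟨Matrix.GeneralLinearGroup.mkOfDetNeZero _ hq • q, ?_⟩
  rw [hg, ← Rat.coe_castHom, OnePoint.map_smul]

/-- Holomorphic on the upper half plane and vanishing at all cusps. -/
def HolCuspidal (k : ℤ) (f : ℍ → ℂ) : Prop :=
  MDiff f ∧ ∀ c : OnePoint ℝ, IsCusp c 𝒮ℒ → c.IsZeroAt f k

lemma HolCuspidal.zero (k : ℤ) : HolCuspidal k 0 :=
  ⟨fun _ => mdifferentiableAt_const, fun _ _ _ _ => by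
    simpa using! Filter.zero_zeroAtFilter _⟩

lemma HolCuspidal.add {k : ℤ} {f g : ℍ → ℂ} (hf : HolCuspidal k f) (hg : HolCuspidal k g) :
    HolCuspidal k (f + g) :=
  ⟨hf.1.add hg.1, fun c hc => (hf.2 c hc).add (hg.2 c hc)⟩

lemma HolCuspidal.smul {k : ℤ} {f : ℍ → ℂ} (c : ℂ) (hf : HolCuspidal k f) :
    HolCuspidal k (c • f) :=
  ⟨hf.1.const_smul c, fun x hx g hg => by
    rw [ModularForm.smul_slash]
    exact (hf.2 x hx g hg).smul _⟩

lemma HolCuspidal.sum {k : ℤ} {ι : Type*} (s : Finset ι) {f : ι → ℍ → ℂ}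
    (hf : ∀ i ∈ s, HolCuspidal k (f i)) : HolCuspidal k (∑ i ∈ s, f i) := by
  classical
  induction s using Finset.induction_on with
  | empty => simpa using HolCuspidal.zero k
  | insert i t hi ih =>
    rw [Finset.sum_insert hi]
    exact (hf i (by simp)).add (ih fun j hj => hf j (by simp [hj]))

lemma HolCuspidal.slash {k : ℤ} {f : ℍ → ℂ} (hf : HolCuspidal k f)
    {M : Matrix (Fin 2) (Fin 2) ℤ} (h : M.det ≠ 0) : HolCuspidal k (f ∣[k] intGL M) :=
  ⟨MDifferentiable.slash hf.1 k _, fun _ hc =>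
    OnePoint.IsZeroAt.smul_iff.mp (hf.2 _ (isCusp_intGL_smul h hc))⟩

lemma isCuspFormWithChar_iff {N k : ℕ} [NeZero N] {ψ : DirichletCharacter ℂ N} {f : ℍ → ℂ} :
    IsCuspFormWithChar N k ψ f ↔ HolCuspidal k f ∧
      ∀ γ ∈ Gamma0 N, f ∣[(k : ℤ)] γ = ψ ((γ 1 1 : ℤ) : ZMod N) • f := by
  have hcusp (c : OnePoint ℝ) :
      IsCusp c ((Gamma1 N).map (Matrix.SpecialLinearGroup.mapGL ℝ)) ↔ IsCusp c 𝒮ℒ :=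
    Subgroup.IsArithmetic.isCusp_iff_isCusp_SL2Z _
  constructor
  · rintro ⟨⟨F, rfl⟩, h⟩
    exact ⟨⟨F.holo', fun c hc => F.zero_at_cusps' ((hcusp c).mpr hc)⟩, h⟩
  · rintro ⟨⟨h1, h2⟩, h⟩
    refine ⟨⟨⟨⟨f, ?_⟩, h1, fun hc => h2 _ ((hcusp _).mp hc)⟩, rfl⟩, h⟩
    rintro _ ⟨γ, hγ, rfl⟩
    have := h γ (Gamma1_in_Gamma0 N hγ)
    rw [((Gamma1_mem N γ).mp hγ).2.1, map_one, one_smul] at this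
    exact this

/-- The matrix `(a b; 0 d)`. -/
def upTri (a b d : ℕ) : Matrix (Fin 2) (Fin 2) ℤ := !![(a : ℤ), (b : ℤ); 0, (d : ℤ)]

lemma det_upTri (a b d : ℕ) : (upTri a b d).det = ((a * d : ℕ) : ℤ) := by
  simp [upTri, Matrix.det_fin_two]

/-- Triples `(a, b, d)` of natural numbers with `a * d = n` and `0 ≤ b < d`. -/
def heckeIndex (n : ℕ) : Finset (ℕ × ℕ × ℕ) :=
  n.divisorsAntidiagonal.biUnion fun x =>
    (Finset.range x.2).image fun b => (x.1, b, x.2)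

lemma mem_heckeIndex {n : ℕ} (hn : n ≠ 0) {x : ℕ × ℕ × ℕ} :
    x ∈ heckeIndex n ↔ x.1 * x.2.2 = n ∧ x.2.1 < x.2.2 := by
  obtain ⟨a, b, d⟩ := x
  simp [heckeIndex, hn]

/-- The classical Hecke operator
`T_n f = ∑_{ad = n} ψ(a) ∑_{0 ≤ b < d} f ∣[k] (a b; 0 d)`,
i.e. `(T_n f)(z) = n ^ (k - 1) ∑ ψ(a) d ^ (-k) f((a z + b) / d)`. -/
def heckeFun (N k : ℕ) (ψ : DirichletCharacter ℂ N) (n : ℕ) (f : ℍ → ℂ) : ℍ → ℂ :=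
  ∑ x ∈ heckeIndex n, ψ (x.1 : ZMod N) • (f ∣[(k : ℤ)] intGL (upTri x.1 x.2.1 x.2.2))

lemma upTri_unique {δ : SL(2, ℤ)} {a b d a' b' d' : ℕ} (ha : 0 < a) (ha' : 0 < a')
    (hb : b < d) (hb' : b' < d')
    (h : (δ : Matrix (Fin 2) (Fin 2) ℤ) * upTri a b d = upTri a' b' d') :
    (a, b, d) = (a', b', d') := by
  have e00 := congrFun₂ h 0 0
  have e01 := congrFun₂ h 0 1
  have e10 := congrFun₂ h 1 0
  have e11 := congrFun₂ h 1 1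
  have hdet := δ.det_coe
  rw [Matrix.det_fin_two] at hdet
  simp [upTri, Matrix.mul_apply, Fin.sum_univ_two] at e00 e01 e10 e11
  have hc : δ.1 1 0 = 0 := by
    rcases e10 with h | h
    · exact h
    · omega
  rw [hc] at e11 hdet
  have hu : δ.1 0 0 * δ.1 1 1 = 1 := by linarith
  have h00 : δ.1 0 0 = 1 := by
    rcases Int.eq_one_or_neg_one_of_mul_eq_one hu with h | h
    · exact h
    · rw [h] at e00; omega
  rw [h00] at hu e00 e01
  have h11 : δ.1 1 1 = 1 := by linarith
  rw [h11] at e11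
  have had : a = a' := by omega
  have hdd : d = d' := by omega
  subst had hdd
  have hbb : (b : ℤ) = b' := by
    have hm : (b' : ℤ) - b = δ.1 0 1 * d := by linarith
    have hz : δ.1 0 1 = 0 := by
      by_contra hne
      have : (d : ℤ) ≤ |δ.1 0 1 * d| := by
        rw [abs_mul, abs_of_nonneg (by positivity : (0 : ℤ) ≤ d)]
        nlinarith [Int.one_le_abs hne]
      rw [← hm] at this
      rcases abs_cases ((b' : ℤ) - b) with h | h <;> omega
    rw [hz] at hm; linarith
  have : b = b' := by exact_mod_cast hbb
  rw [this]

lemma exists_upTri {N n : ℕ} (hn : 0 < n) {M : Matrix (Fin 2) (Fin 2) ℤ} (hM : M.det = n)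
    (hc : (N : ℤ) ∣ M 1 0) (ha : IsCoprime (M 0 0) (N : ℤ)) :
    ∃ δ ∈ Gamma0 N, ∃ x ∈ heckeIndex n,
      M = (δ : Matrix (Fin 2) (Fin 2) ℤ) * upTri x.1 x.2.1 x.2.2 := by
  set A := M 0 0 with hA
  set C := M 1 0 with hC
  have hdet : A * M 1 1 - M 0 1 * C = n := by rw [← hM, Matrix.det_fin_two]
  have hg0 : 0 < Int.gcd A C := by
    rw [Int.gcd_pos_iff]
    by_contra! h
    rw [h.1, h.2] at hdet
    simp at hdet; omega
  set g := Int.gcd A C with hg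
  obtain ⟨A', hA'⟩ : (g : ℤ) ∣ A := Int.gcd_dvd_left _ _
  obtain ⟨C', hC'⟩ : (g : ℤ) ∣ C := Int.gcd_dvd_right _ _
  have hbez : (g : ℤ) = A * Int.gcdA A C + C * Int.gcdB A C := Int.gcd_eq_gcd_ab A C
  set u := Int.gcdA A C
  set v := Int.gcdB A C
  have hgz : (g : ℤ) ≠ 0 := by exact_mod_cast hg0.ne'
  have huv : A' * u + C' * v = 1 := by
    apply mul_left_cancel₀ hgz
    rw [mul_one]
    calc (g : ℤ) * (A' * u + C' * v) = (g * A') * u + (g * C') * v := by ring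
      _ = g := by rw [← hA', ← hC', ← hbez]
  have hNC : (N : ℤ) ∣ C' := by
    have h1 : IsCoprime (g : ℤ) (N : ℤ) := ha.of_isCoprime_of_dvd_left ⟨A', hA'⟩
    exact h1.symm.dvd_of_dvd_mul_left (hC' ▸ hc)
  -- the bottom right entry after row reduction
  set B := u * M 0 1 + v * M 1 1 with hB
  set D := A' * M 1 1 - C' * M 0 1 with hD
  have hgD : (g : ℤ) * D = n := by
    rw [hD, ← hdet, hA', hC']; ring
  have hDpos : 0 < D := by
    have : 0 < (g : ℤ) * D := by rw [hgD]; exact_mod_cast hn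
    exact pos_of_mul_pos_right this (by positivity)
  set j := B / D with hj
  let δ : SL(2, ℤ) := ⟨!![A', A' * j - v; C', C' * j + u], by
    rw [Matrix.det_fin_two_of]; linear_combination huv⟩
  have hmod0 := Int.emod_nonneg B hDpos.ne'
  have hmodl := Int.emod_lt_of_pos B hDpos
  have hmod : B % D + D * j = B := Int.emod_add_mul_ediv B D
  refine ⟨δ, ?_, (g, (B % D).toNat, D.toNat), ?_, ?_⟩
  · rw [Gamma0_mem]
    exact (ZMod.intCast_zmod_eq_zero_iff_dvd _ _).mpr hNC
  · rw [mem_heckeIndex hn.ne']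
    refine ⟨?_, ?_⟩
    · have : ((g * D.toNat : ℕ) : ℤ) = n := by
        push_cast; rw [Int.toNat_of_nonneg hDpos.le, hgD]
      exact_mod_cast this
    · show (B % D).toNat < D.toNat
      omega
  · have e1 : (((B % D).toNat : ℕ) : ℤ) = B % D := Int.toNat_of_nonneg hmod0
    have e2 : ((D.toNat : ℕ) : ℤ) = D := Int.toNat_of_nonneg hDpos.le
    have key01 : M 0 1 = A' * (B % D) + (A' * j - v) * D := by
      have : A' * (B % D) + (A' * j - v) * D = A' * B - v * D := by linear_combination A' * hmod
      rw [this, hB, hD]; linear_combination (-M 0 1) * huv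
    have key11 : M 1 1 = C' * (B % D) + (C' * j + u) * D := by
      have : C' * (B % D) + (C' * j + u) * D = C' * B + u * D := by linear_combination C' * hmod
      rw [this, hB, hD]; linear_combination (-M 1 1) * huv
    ext i k
    fin_cases i <;> fin_cases k
    · simp [δ, upTri, Matrix.mul_apply, Fin.sum_univ_two, ← hA]; rw [hA']; ring
    · simp [δ, upTri, Matrix.mul_apply, Fin.sum_univ_two, e1, e2]; exact key01
    · simp [δ, upTri, Matrix.mul_apply, Fin.sum_univ_two, ← hC]; rw [hC']; ring
    · simp [δ, upTri, Matrix.mul_apply, Fin.sum_univ_two, e1, e2]; exact key11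


lemma heckeFun_slash {N k n : ℕ} (hn : 0 < n) {ψ : DirichletCharacter ℂ N} {f : ℍ → ℂ}
    (hf : ∀ γ ∈ Gamma0 N, f ∣[(k : ℤ)] γ = ψ ((γ 1 1 : ℤ) : ZMod N) • f)
    {γ : SL(2, ℤ)} (hγ : γ ∈ Gamma0 N) :
    heckeFun N k ψ n f ∣[(k : ℤ)] γ = ψ ((γ 1 1 : ℤ) : ZMod N) • heckeFun N k ψ n f := by
  classical
  set F : ℕ × ℕ × ℕ → ℍ → ℂ :=
    fun x => ψ (x.1 : ZMod N) • (f ∣[(k : ℤ)] intGL (upTri x.1 x.2.1 x.2.2)) with hF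
  set I := (heckeIndex n).filter fun x => IsUnit (x.1 : ZMod N) with hI
  have hsum : heckeFun N k ψ n f = ∑ x ∈ I, F x := by
    rw [hI, Finset.sum_filter_of_ne]
    · rfl
    · intro x _ hx
      by_contra h
      exact hx (by simp [hF, ψ.map_nonunit h])
  have hdet (x : ℕ × ℕ × ℕ) (hx : x ∈ heckeIndex n) :
      (upTri x.1 x.2.1 x.2.2).det = (n : ℤ) := by
    rw [det_upTri, ((mem_heckeIndex hn.ne').mp hx).1]
  have hn' : ((n : ℕ) : ℤ) ≠ 0 := by exact_mod_cast hn.ne'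
  have hγ10 : (((γ 1 0 : ℤ)) : ZMod N) = 0 := hγ
  have hunit {δ : SL(2, ℤ)} (hδ : δ ∈ Gamma0 N) :
      ((δ 0 0 : ℤ) : ZMod N) * ((δ 1 1 : ℤ) : ZMod N) = 1 := by
    have h0 : (((δ 1 0 : ℤ)) : ZMod N) = 0 := hδ
    have := δ.det_coe
    rw [Matrix.det_fin_two] at this
    have := congrArg (Int.cast : ℤ → ZMod N) this
    push_cast at this
    simpa [h0] using this
  have hex (x : ℕ × ℕ × ℕ) (hx : x ∈ I) : ∃ δ ∈ Gamma0 N, ∃ y ∈ heckeIndex n,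
      upTri x.1 x.2.1 x.2.2 * (γ : Matrix (Fin 2) (Fin 2) ℤ) =
        (δ : Matrix (Fin 2) (Fin 2) ℤ) * upTri y.1 y.2.1 y.2.2 := by
    obtain ⟨hx1, hx2⟩ := Finset.mem_filter.mp hx
    apply exists_upTri hn
    · rw [Matrix.det_mul, hdet x hx1]; simp
    · rw [← ZMod.intCast_zmod_eq_zero_iff_dvd]
      simp [upTri, Matrix.mul_apply, Fin.sum_univ_two, hγ10]
    · have h1 : IsUnit (((upTri x.1 x.2.1 x.2.2 *
          (γ : Matrix (Fin 2) (Fin 2) ℤ)) 0 0 : ℤ) : ZMod N) := by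
        have : (((upTri x.1 x.2.1 x.2.2 * (γ : Matrix (Fin 2) (Fin 2) ℤ)) 0 0 : ℤ) : ZMod N)
            = (x.1 : ZMod N) * ((γ 0 0 : ℤ) : ZMod N) := by
          simp [upTri, Matrix.mul_apply, Fin.sum_univ_two, hγ10]
        rw [this]
        exact hx2.mul (IsUnit.of_mul_eq_one _ (hunit hγ))
      exact (ZMod.coe_int_isUnit_iff_isCoprime _ _).mp h1 |>.symm
  choose! δ hδ y hy hxy using hex
  have hrel (x) (hx : x ∈ I) : (x.1 : ZMod N) * ((γ 0 0 : ℤ) : ZMod N) =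
      ((δ x 0 0 : ℤ) : ZMod N) * ((y x).1 : ZMod N) := by
    have := congrArg (Int.cast : ℤ → ZMod N) (congrFun₂ (hxy x hx) 0 0)
    simpa [upTri, Matrix.mul_apply, Fin.sum_univ_two, hγ10] using this
  have hyI (x) (hx : x ∈ I) : y x ∈ I := by
    refine Finset.mem_filter.mpr ⟨hy x hx, ?_⟩
    have h1 : IsUnit ((x.1 : ZMod N) * ((γ 0 0 : ℤ) : ZMod N)) :=
      (Finset.mem_filter.mp hx).2.mul (IsUnit.of_mul_eq_one _ (hunit hγ))
    rw [hrel x hx] at h1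
    exact (IsUnit.mul_iff.mp h1).2
  have hpos (x) (hx : x ∈ heckeIndex n) : 0 < x.1 ∧ x.2.1 < x.2.2 := by
    obtain ⟨h1, h2⟩ := (mem_heckeIndex hn.ne').mp hx
    exact ⟨Nat.pos_of_ne_zero fun h => by rw [h, zero_mul] at h1; omega, h2⟩
  have hinj : Set.InjOn y (I : Set (ℕ × ℕ × ℕ)) := by
    intro x hx x' hx' hyy
    have hx : x ∈ I := hx
    have hx' : x' ∈ I := hx'
    have hxn := (Finset.mem_filter.mp hx).1
    have hxn' := (Finset.mem_filter.mp hx').1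
    have e1 := hxy x hx
    have e2 := hxy x' hx'
    rw [← hyy] at e2
    have hk : ((δ x' * (δ x)⁻¹ : SL(2, ℤ)) : Matrix (Fin 2) (Fin 2) ℤ) *
        upTri x.1 x.2.1 x.2.2 = upTri x'.1 x'.2.1 x'.2.2 := by
      have hγγ : (γ : Matrix (Fin 2) (Fin 2) ℤ) * ((γ⁻¹ : SL(2, ℤ)) : Matrix (Fin 2) (Fin 2) ℤ)
          = 1 := by rw [← Matrix.SpecialLinearGroup.coe_mul]; simp
      have hδδ : (((δ x)⁻¹ : SL(2, ℤ)) : Matrix (Fin 2) (Fin 2) ℤ) *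
          ((δ x : SL(2, ℤ)) : Matrix (Fin 2) (Fin 2) ℤ) = 1 := by
        rw [← Matrix.SpecialLinearGroup.coe_mul]; simp
      have e1' : upTri x.1 x.2.1 x.2.2 = (δ x : Matrix (Fin 2) (Fin 2) ℤ) *
          upTri (y x).1 (y x).2.1 (y x).2.2 *
            ((γ⁻¹ : SL(2, ℤ)) : Matrix (Fin 2) (Fin 2) ℤ) := by
        rw [← e1, Matrix.mul_assoc, hγγ, Matrix.mul_one]
      have e2' : upTri x'.1 x'.2.1 x'.2.2 = (δ x' : Matrix (Fin 2) (Fin 2) ℤ) *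
          upTri (y x).1 (y x).2.1 (y x).2.2 *
            ((γ⁻¹ : SL(2, ℤ)) : Matrix (Fin 2) (Fin 2) ℤ) := by
        rw [← e2, Matrix.mul_assoc, hγγ, Matrix.mul_one]
      rw [e1', e2', Matrix.SpecialLinearGroup.coe_mul]
      simp only [Matrix.mul_assoc]
      rw [← Matrix.mul_assoc (((δ x)⁻¹ : SL(2, ℤ)) : Matrix (Fin 2) (Fin 2) ℤ), hδδ,
        Matrix.one_mul]
    exact upTri_unique (hpos x hxn).1 (hpos x' hxn').1 (hpos x hxn).2 (hpos x' hxn').2 hk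
  have hterm (x) (hx : x ∈ I) : F x ∣[(k : ℤ)] γ = ψ ((γ 1 1 : ℤ) : ZMod N) • F (y x) := by
    have hxn := (Finset.mem_filter.mp hx).1
    have h1 : (upTri x.1 x.2.1 x.2.2).det ≠ 0 := by rw [hdet x hxn]; exact hn'
    have h2 : (upTri (y x).1 (y x).2.1 (y x).2.2).det ≠ 0 := by
      rw [hdet _ (hy x hx)]; exact hn'
    have h3 : 0 < (upTri (y x).1 (y x).2.1 (y x).2.2).det := by
      rw [hdet _ (hy x hx)]; exact_mod_cast hn
    have hslash : (f ∣[(k : ℤ)] intGL (upTri x.1 x.2.1 x.2.2)) ∣[(k : ℤ)] γ =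
        ψ ((δ x 1 1 : ℤ) : ZMod N) •
          (f ∣[(k : ℤ)] intGL (upTri (y x).1 (y x).2.1 (y x).2.2)) := by
      rw [ModularForm.SL_slash, ← SlashAction.slash_mul]
      have : intGL (upTri x.1 x.2.1 x.2.2) * (γ : GL (Fin 2) ℝ) =
          (δ x : GL (Fin 2) ℝ) * intGL (upTri (y x).1 (y x).2.1 (y x).2.2) := by
        have e := congrArg intGL (hxy x hx)
        rw [intGL_mul_SL h1, intGL_SL_mul h2] at e
        exact e
      rw [this, SlashAction.slash_mul, ← ModularForm.SL_slash, hf _ (hδ x hx),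
        smul_slash_intGL h3]
    simp only [hF]
    rw [ModularForm.SL_smul_slash, hslash, smul_smul, smul_smul, ← map_mul, ← map_mul]
    congr 2
    have r := hrel x hx
    have u1 := hunit hγ
    have u2 := hunit (hδ x hx)
    linear_combination (-(x.1 : ZMod N) * ((δ x 1 1 : ℤ) : ZMod N)) * u1 +
      ((δ x 1 1 : ℤ) : ZMod N) * ((γ 1 1 : ℤ) : ZMod N) * r +
      ((γ 1 1 : ℤ) : ZMod N) * ((y x).1 : ZMod N) * u2
  rw [hsum, SlashAction.sum_slash, Finset.sum_congr rfl hterm, ← Finset.smul_sum]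
  congr 1
  have hmaps : Set.MapsTo y (I : Set (ℕ × ℕ × ℕ)) (I : Set (ℕ × ℕ × ℕ)) := fun x hx => hyI x hx
  exact Finset.sum_nbij y (fun x hx => hyI x hx) hinj
    (Finset.surjOn_of_injOn_of_card_le y hmaps hinj le_rfl) fun _ _ => rfl

lemma isCuspFormWithChar_heckeFun {N k n : ℕ} [NeZero N] (hn : 0 < n)
    {ψ : DirichletCharacter ℂ N} {f : ℍ → ℂ} (hf : IsCuspFormWithChar N k ψ f) :
    IsCuspFormWithChar N k ψ (heckeFun N k ψ n f) := by
  rw [isCuspFormWithChar_iff] at hf ⊢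
  refine ⟨HolCuspidal.sum _ fun x hx => ((hf.1.slash ?_).smul _),
    fun γ hγ => heckeFun_slash hn hf.2 hγ⟩
  rw [det_upTri, ((mem_heckeIndex hn.ne').mp hx).1]
  exact_mod_cast hn.ne'

/-- `f(z) = ∑_{m ≥ 0} α_m q ^ m` with `q = exp(2πiz)`, for all `z` in the upper half plane. -/
def HasQExpansion (α : ℕ → ℂ) (f : ℍ → ℂ) : Prop :=
  ∀ z : ℍ, HasSum (fun m : ℕ => α m * Complex.exp (2 * Real.pi * Complex.I * m * z)) (f z)

lemma slash_upTri {k : ℤ} {a b d : ℕ} (ha : 0 < a) (hd : 0 < d) (f : ℍ → ℂ) (z : ℍ) :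
    ∃ w : ℍ, (w : ℂ) = (a * z + b) / d ∧
      (f ∣[k] intGL (upTri a b d)) z = f w * ((a : ℂ) * d) ^ (k - 1) * (d : ℂ) ^ (-k) := by
  have h : 0 < (upTri a b d).det := by rw [det_upTri]; exact_mod_cast Nat.mul_pos ha hd
  have hc := coe_intGL h.ne'
  have hdt : (intGL (upTri a b d)).det.val = (a : ℝ) * d := by
    rw [Matrix.GeneralLinearGroup.val_det_apply, hc, det_map_cast, det_upTri]; push_cast; rfl
  have e00 : intGL (upTri a b d) 0 0 = (a : ℝ) := by rw [hc]; simp [upTri]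
  have e01 : intGL (upTri a b d) 0 1 = (b : ℝ) := by rw [hc]; simp [upTri]
  have e10 : intGL (upTri a b d) 1 0 = 0 := by rw [hc]; simp [upTri]
  have e11 : intGL (upTri a b d) 1 1 = (d : ℝ) := by rw [hc]; simp [upTri]
  refine ⟨intGL (upTri a b d) • z, ?_, ?_⟩
  · rw [UpperHalfPlane.coe_smul_of_det_pos (det_intGL_pos h), num, denom, e00, e01, e10, e11]
    simp
  · rw [ModularForm.slash_apply, hdt]
    have hp := det_intGL_pos h
    have h0 : (0 : ℝ) ≤ (a : ℝ) * d := by positivity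
    simp only [UpperHalfPlane.σ, if_pos hp, abs_of_nonneg h0]
    rw [denom, e10, e11]
    simp

lemma sum_exp_div (d m : ℕ) (hd : 0 < d) :
    ∑ b ∈ Finset.range d, Complex.exp (2 * Real.pi * Complex.I * m * b / d) =
      if d ∣ m then (d : ℂ) else 0 := by
  have hprim := Complex.isPrimitiveRoot_exp d hd.ne'
  set ζ := Complex.exp (2 * Real.pi * Complex.I / d) with hζ
  have hterm (b : ℕ) : Complex.exp (2 * Real.pi * Complex.I * m * b / d) = (ζ ^ m) ^ b := by
    rw [hζ, ← Complex.exp_nat_mul, ← Complex.exp_nat_mul]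
    congr 1; ring
  simp only [hterm]
  split_ifs with h
  · rw [(hprim.pow_eq_one_iff_dvd m).mpr h]; simp
  · have h1 : ζ ^ m ≠ 1 := fun e => h ((hprim.pow_eq_one_iff_dvd m).mp e)
    rw [geom_sum_eq h1, ← pow_mul, mul_comm, pow_mul, hprim.pow_eq_one]; simp

/-- `a_m(T_n f) = ∑_{ad = n, a ∣ m} ψ(a) a ^ (k - 1) a_{dm/a}(f)`. -/
lemma hasQExpansion_heckeFun {N k n : ℕ} (hn : 0 < n) {ψ : DirichletCharacter ℂ N}
    {α : ℕ → ℂ} {f : ℍ → ℂ} (hf : HasQExpansion α f) :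
    HasQExpansion (fun m => ∑ x ∈ n.divisorsAntidiagonal,
      if x.1 ∣ m then ψ (x.1 : ZMod N) * (x.1 : ℂ) ^ ((k : ℤ) - 1) * α (x.2 * (m / x.1)) else 0)
      (heckeFun N k ψ n f) := by
  intro z
  have hdisj : heckeFun N k ψ n f z = ∑ x ∈ n.divisorsAntidiagonal,
      ∑ b ∈ Finset.range x.2,
        ψ (x.1 : ZMod N) * (f ∣[(k : ℤ)] intGL (upTri x.1 b x.2)) z := by
    rw [heckeFun, heckeIndex, Finset.sum_biUnion, Finset.sum_apply]
    · refine Finset.sum_congr rfl fun x _ => ?_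
      rw [Finset.sum_image (by intro b _ c _ h; simpa using h), Finset.sum_apply]
      rfl
    · intro x _ y _ hxy
      rw [Function.onFun, Finset.disjoint_left]
      intro t ht ht'
      simp only [Finset.mem_image] at ht ht'
      obtain ⟨b, _, rfl⟩ := ht
      obtain ⟨c, _, h⟩ := ht'
      simp only [Prod.mk.injEq] at h
      exact hxy (Prod.ext h.1.symm h.2.2.symm)
  rw [hdisj]
  simp only [Finset.sum_mul]
  refine hasSum_sum fun x hx => ?_
  obtain ⟨a, d⟩ := x
  obtain ⟨had, -⟩ := Nat.mem_divisorsAntidiagonal.mp hx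
  simp only at had ⊢
  have ha : 0 < a := Nat.pos_of_ne_zero fun h => by rw [h, zero_mul] at had; omega
  have hd : 0 < d := Nat.pos_of_ne_zero fun h => by rw [h, mul_zero] at had; omega
  have hdC : (d : ℂ) ≠ 0 := by exact_mod_cast hd.ne'
  have haC : (a : ℂ) ≠ 0 := by exact_mod_cast ha.ne'
  set e : ℂ → ℂ := fun t => Complex.exp (2 * Real.pi * Complex.I * t) with he
  set c : ℂ := ((a : ℂ) * d) ^ ((k : ℤ) - 1) * (d : ℂ) ^ (-(k : ℤ)) with hc
  have hcd : c * d = (a : ℂ) ^ ((k : ℤ) - 1) := by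
    rw [hc, mul_zpow, mul_assoc, mul_assoc, ← zpow_add_one₀ hdC, ← zpow_add₀ hdC]
    simp
  have h1 : HasSum (fun m : ℕ => if d ∣ m then
      ψ (a : ZMod N) * (a : ℂ) ^ ((k : ℤ) - 1) * α m * e ((m : ℂ) * a * z / d) else 0)
      (∑ b ∈ Finset.range d, ψ (a : ZMod N) * (f ∣[(k : ℤ)] intGL (upTri a b d)) z) := by
    have : ∀ b ∈ Finset.range d, HasSum (fun m : ℕ => ψ (a : ZMod N) * c * α m *
        (e ((m : ℂ) * a * z / d) * Complex.exp (2 * Real.pi * Complex.I * m * b / d)))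
        (ψ (a : ZMod N) * (f ∣[(k : ℤ)] intGL (upTri a b d)) z) := by
      intro b _
      obtain ⟨w, hw, hs⟩ := slash_upTri (k := k) (b := b) ha hd f z
      rw [hs]
      have hmul := (hf w).mul_left (ψ (a : ZMod N) * c)
      have hfun : (fun m : ℕ => ψ (a : ZMod N) * c * α m *
          (e ((m : ℂ) * a * z / d) * Complex.exp (2 * Real.pi * Complex.I * m * b / d))) =
          fun m : ℕ => ψ (a : ZMod N) * c *
            (α m * Complex.exp (2 * Real.pi * Complex.I * m * w)) := by
        funext m
        rw [he, ← Complex.exp_add, hw, mul_assoc (ψ (a : ZMod N) * c)]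
        congr 3
        ring
      rw [hfun]
      have hval : ψ (a : ZMod N) * (f w * ((a : ℂ) * d) ^ ((k : ℤ) - 1) * (d : ℂ) ^ (-(k : ℤ))) =
          ψ (a : ZMod N) * c * f w := by rw [hc]; ring
      rw [hval]
      exact hmul
    convert hasSum_sum this using 1
    funext m
    rw [← Finset.mul_sum, ← Finset.mul_sum, sum_exp_div d m hd]
    split_ifs
    · rw [← hcd]; ring
    · simp
  have inj (t : ℕ) (ht : 0 < t) : Function.Injective fun m : ℕ => t * m :=
    fun u v h => Nat.eq_of_mul_eq_mul_left ht h
  have h2 := ((inj d hd).hasSum_iff (fun m hm => by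
    rw [if_neg]
    rintro ⟨t, rfl⟩
    exact hm ⟨t, rfl⟩)).mpr h1
  refine ((inj a ha).hasSum_iff (fun m hm => by
    rw [if_neg, zero_mul]
    rintro ⟨t, rfl⟩
    exact hm ⟨t, rfl⟩)).mp ?_
  convert h2 using 1
  funext m
  simp only [Function.comp_apply, dvd_mul_right, if_true, Nat.mul_div_cancel_left m ha]
  rw [he]
  congr 2
  push_cast
  field_simp


lemma HasQExpansion.add {α β : ℕ → ℂ} {f g : ℍ → ℂ} (hf : HasQExpansion α f)
    (hg : HasQExpansion β g) : HasQExpansion (α + β) (f + g) := fun z => by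
  simpa [add_mul] using (hf z).add (hg z)

lemma HasQExpansion.smul (c : ℂ) {α : ℕ → ℂ} {f : ℍ → ℂ} (hf : HasQExpansion α f) :
    HasQExpansion (fun m => c * α m) (c • f) := fun z => by
  simpa [mul_assoc] using (hf z).mul_left c

/-- The ring of integers `𝒪_K` of a finite extension `K` of `ℚ_p`: the integral closure of
`ℤ_p` in `K`. -/
def PadicRingOfIntegers (p : ℕ) [Fact p.Prime] (K : Type*) [Field K] [Algebra ℚ_[p] K] :
    Type _ :=
  integralClosure (PadicInt.subring p) K

instance (p : ℕ) [Fact p.Prime] (K : Type*) [Field K] [Algebra ℚ_[p] K] :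
    CommRing (PadicRingOfIntegers p K) :=
  inferInstanceAs (CommRing (integralClosure (PadicInt.subring p) K))

instance (p : ℕ) [Fact p.Prime] (K : Type*) [Field K] [Algebra ℚ_[p] K] :
    Algebra (PadicRingOfIntegers p K) K :=
  inferInstanceAs (Algebra (integralClosure (PadicInt.subring p) K) K)

section HeckeAlgebra

variable {p : ℕ} [Fact p.Prime] {K : Type*} [Field K] [Algebra ℚ_[p] K] [Algebra K ℂ]
  {N : ℕ} [NeZero N] (k : ℕ) (χ : DirichletCharacter (PadicRingOfIntegers p K) N)

/-- The complex Dirichlet character obtained from `χ` through `𝒪_K ⊆ K → ℂ`. -/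
def complexChar : DirichletCharacter ℂ N :=
  χ.ringHomComp ((algebraMap K ℂ).comp (algebraMap (PadicRingOfIntegers p K) K))

/-- The `K`-vector space `S_k(Γ₁(N), χ, K)` of cusp forms of weight `k`, level `Γ₁(N)` and
character `χ` all of whose Fourier coefficients lie in `K`, the field `K` being
embedded in `ℂ` by `algebraMap K ℂ`. -/
def cuspSpace : Submodule K (ℍ → ℂ) where
  carrier := {f | IsCuspFormWithChar N k (complexChar χ) f ∧
    ∃ a : ℕ → K, HasQExpansion (fun m => algebraMap K ℂ (a m)) f}
  zero_mem' := by
    refine ⟨isCuspFormWithChar_iff.mpr ⟨HolCuspidal.zero _, fun γ _ => by simp⟩, 0, fun z => ?_⟩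
    simp
  add_mem' := by
    rintro f g ⟨hf, a, ha⟩ ⟨hg, b, hb⟩
    rw [isCuspFormWithChar_iff] at hf hg
    refine ⟨isCuspFormWithChar_iff.mpr ⟨hf.1.add hg.1, fun γ hγ => ?_⟩, a + b, ?_⟩
    · rw [SlashAction.add_slash, hf.2 γ hγ, hg.2 γ hγ, smul_add]
    · convert ha.add hb using 1
      funext m; simp
  smul_mem' := by
    rintro c f ⟨hf, a, ha⟩
    rw [isCuspFormWithChar_iff] at hf
    have hc : c • f = algebraMap K ℂ c • f := by
      funext z; simp [Algebra.smul_def]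
    rw [hc]
    refine ⟨isCuspFormWithChar_iff.mpr ⟨hf.1.smul _, fun γ hγ => ?_⟩, fun m => c * a m, ?_⟩
    · rw [ModularForm.SL_smul_slash, hf.2 γ hγ, smul_comm]
    · convert ha.smul (algebraMap K ℂ c) using 1
      funext m; simp

lemma heckeFun_mem (n : ℕ) {f : ℍ → ℂ} (hf : f ∈ cuspSpace k χ) :
    heckeFun N k (complexChar χ) n f ∈ cuspSpace k χ := by
  rcases Nat.eq_zero_or_pos n with rfl | hn
  · have : heckeFun N k (complexChar χ) 0 f = 0 := by simp [heckeFun, heckeIndex]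
    rw [this]; exact zero_mem _
  · obtain ⟨h, a, ha⟩ := hf
    refine ⟨isCuspFormWithChar_heckeFun hn h, fun m => ∑ x ∈ n.divisorsAntidiagonal,
      if x.1 ∣ m then algebraMap (PadicRingOfIntegers p K) K (χ (x.1 : ZMod N)) * (x.1 : K) ^ ((k : ℤ) - 1) * a (x.2 * (m / x.1))
      else 0, ?_⟩
    convert hasQExpansion_heckeFun (N := N) (k := k) (ψ := complexChar χ) hn ha using 1
    funext m
    rw [map_sum]
    refine Finset.sum_congr rfl fun x _ => ?_
    split_ifs
    · simp [complexChar]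
    · simp

/-- The Hecke operator `T_n` on `S_k(Γ₁(N), χ, K)`. -/
def heckeEnd (n : ℕ) : Module.End K (cuspSpace k χ) where
  toFun f := ⟨heckeFun N k (complexChar χ) n f, heckeFun_mem k χ n f.2⟩
  map_add' f g := by
    apply Subtype.ext
    simp [heckeFun, Finset.sum_add_distrib]
  map_smul' c f := by
    apply Subtype.ext
    have hc (f : ℍ → ℂ) : c • f = algebraMap K ℂ c • f := by
      funext z; simp [Algebra.smul_def]
    rcases Nat.eq_zero_or_pos n with rfl | hn
    · simp [heckeFun, heckeIndex]
    · show heckeFun N k (complexChar χ) n (c • (f : ℍ → ℂ)) =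
        c • heckeFun N k (complexChar χ) n (f : ℍ → ℂ)
      rw [hc, hc, heckeFun, heckeFun, Finset.smul_sum]
      refine Finset.sum_congr rfl fun x hx => ?_
      rw [smul_slash_intGL, smul_comm]
      rw [det_upTri, ((mem_heckeIndex hn.ne').mp hx).1]
      exact_mod_cast hn

/-- `End_K(S_k(Γ₁(N), χ, K))` as an `𝒪_K`-algebra, by restriction of scalars from `K`. -/
instance : Algebra (PadicRingOfIntegers p K) (Module.End K (cuspSpace k χ)) :=
  Algebra.compHom _ (algebraMap (PadicRingOfIntegers p K) K)

/-- The Hecke algebra `𝕋_N`: the `𝒪_K`-subalgebra of `End_K(S_k(Γ₁(N), χ, K))` generated by the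
Hecke operators `T_n`, `n ≥ 1`. -/
def HeckeAlgebra : Subalgebra (PadicRingOfIntegers p K) (Module.End K (cuspSpace k χ)) :=
  Algebra.adjoin (PadicRingOfIntegers p K) {T | ∃ n : ℕ, 1 ≤ n ∧ T = heckeEnd k χ n}

instance : Ring (HeckeAlgebra k χ) :=
  @Subalgebra.toRing (PadicRingOfIntegers p K) (Module.End K (cuspSpace k χ)) _ _ _
    (HeckeAlgebra k χ)

/-- The operator `T_n`, `n ≥ 1`, as an element of the Hecke algebra. -/
def heckeT (n : ℕ) (hn : 1 ≤ n) : HeckeAlgebra k χ :=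
  ⟨heckeEnd k χ n, Algebra.subset_adjoin ⟨n, hn, rfl⟩⟩

/-- The modified diamond operator `S_m = m ^ (k - 2) χ(m)`, a scalar operator. -/
def heckeS (m : ℕ) : HeckeAlgebra k χ :=
  algebraMap (PadicRingOfIntegers p K) (HeckeAlgebra k χ)
    ((m : PadicRingOfIntegers p K) ^ (k - 2) * χ (m : ZMod N))

/-- `l ^ ((k - 2) / 2)`, where `s` is a chosen square root of `l` that is used only if `k` is
odd. -/
def halfPow {R : Type*} [CommRing R] (k l : ℕ) (s : R) : R :=
  if Even k then (l : R) ^ ((k - 2) / 2) else s ^ (k - 2)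

/-- The operator `R_l = l ^ ((k - 2) / 2) ζ`, where `ζ` is a chosen square root of `χ(l)` and `s`
is a chosen square root of `l` (used only if `k` is odd). -/
def heckeR (l : ℕ) (ζ s : PadicRingOfIntegers p K) : HeckeAlgebra k χ :=
  algebraMap (PadicRingOfIntegers p K) (HeckeAlgebra k χ) (halfPow k l s * ζ)

/-- `R_l ^ 2 = S_l`. -/
lemma heckeR_sq (hk : 2 ≤ k) {l : ℕ} {ζ s : PadicRingOfIntegers p K} (hζ : ζ ^ 2 = χ (l : ZMod N))
    (hs : Odd k → s ^ 2 = l) : heckeR k χ l ζ s ^ 2 = heckeS k χ l := by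
  rw [heckeR, heckeS, ← map_pow, mul_pow, hζ, halfPow]
  congr 2
  split_ifs with h
  · rw [← pow_mul, Nat.div_mul_cancel]
    exact ((Nat.even_sub hk).mpr (by simp [h])).two_dvd
  · rw [← pow_mul, mul_comm, pow_mul, hs (Nat.not_even_iff_odd.mp h)]

/-- Cuspidal eigenforms modulo `π ^ r` of level `N`, weight `k` and character `χ`. -/
abbrev EigenformMod (π : PadicRingOfIntegers p K) (r : ℕ) : Type _ :=
  HeckeAlgebra k χ →ₐ[PadicRingOfIntegers p K]
    (PadicRingOfIntegers p K ⧸ Ideal.span {π ^ r})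

variable {k χ} {π : PadicRingOfIntegers p K} {r : ℕ}

/-- The reduction `f_s` of an eigenform `f` modulo `π ^ r` to an eigenform modulo `π ^ s`,
`s ≤ r`. -/
def EigenformMod.reduce (f : EigenformMod k χ π r) {s : ℕ} (h : s ≤ r) : EigenformMod k χ π s :=
  (Ideal.Quotient.factorₐ (PadicRingOfIntegers p K)
    (Ideal.span_singleton_le_span_singleton.mpr (pow_dvd_pow π h))).comp f

/-- Condition `(LRC)²` at `l`: `T_l ^ 2 - (l + 1) ^ 2 S_l ∈ ker f`. -/
def LRCsq (f : EigenformMod k χ π r) (l : ℕ) (hl : 1 ≤ l) : Prop :=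
  heckeT k χ l hl ^ 2 - ((l : HeckeAlgebra k χ) + 1) ^ 2 * heckeS k χ l ∈ RingHom.ker f

/-- Condition `(LRC)_ε` at `l`: `T_l - ε (l + 1) R_l ∈ ker f`, where `R_l` is formed with the
chosen square roots `ζ` of `χ(l)` and `s` of `l`. -/
def LRC (f : EigenformMod k χ π r) (l : ℕ) (hl : 1 ≤ l) (ζ s : PadicRingOfIntegers p K)
    (ε : ℤˣ) : Prop :=
  heckeT k χ l hl - ((ε : ℤ) : HeckeAlgebra k χ) * ((l : HeckeAlgebra k χ) + 1) *
    heckeR k χ l ζ s ∈ RingHom.ker f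

end HeckeAlgebra

end LevelRaising

end

/-! ### Divisibility by powers of a prime element -/

namespace LevelRaising

/-! Everything reduces to a difference of two squares in the domain 𝒪_K. Let `a` be a lift to 𝒪_K of
`f(T_l)`, and let `x = (l + 1) R_l`, seen as an element of 𝒪_K. Since `f` is an 𝒪_K-algebra
homomorphism and `R_l ^ 2 = S_l`, (LRC)² says that `π ^ r` divides `a² - x² = (a - x)(a + x)`, while
s-(LRC)_ε says that `π ^ s` divides `a - εx` (`lrcsq_iff`, `lrc_iff`).

The two factors differ by `2x`. As `p` is odd and `l ∤ pN`, the elements `2`, `l` and `χ(l)` are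
units, hence so is `R_l`, and `2x` has the same valuation `v` as `l + 1`. So `π ^ (v + 1)` cannot
divide both factors: one of them absorbs at most `π ^ v`, and the other is divisible by `π ^ (r -
v)`. This is `exists_sign_of_pow_dvd_sq_sub_sq`. Lifting to 𝒪_K is what makes valuations available,
as the quotient by `π ^ r` has zero divisors in general.

The argument needs the uniformizer to be a prime element. This comes from 𝒪_K being a valuation
ring, by way of the spectral norm; discreteness of the valuation plays no role. -/

lemma _root_.Prime.pow_sub_dvd_of_pow_dvd_mul {R : Type*} [CommRing R] [IsDomain R] {π a b : R}
    (hπ : Prime π) {r v : ℕ} (ha : ¬ π ^ (v + 1) ∣ a) (h : π ^ r ∣ a * b) : π ^ (r - v) ∣ b := by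
  -- Multiplicities are taken in `ℕ∞`, so `b = 0` needs no separate case. They add under products
  -- because `π` is prime.
  rw [pow_dvd_iff_le_emultiplicity] at ha h ⊢
  rw [emultiplicity_mul hπ] at h
  have hv : emultiplicity π a ≤ v := by
    rw [not_le] at ha
    exact Order.lt_add_one_iff_of_not_isMax (by simp) |>.mp (by exact_mod_cast ha)
  rw [ENat.natCast_sub, tsub_le_iff_left]
  exact h.trans (by gcongr)

/-- If `a² ≡ x²` modulo `π ^ r` and `2 x` is not divisible by `π ^ (v + 1)`, then `a ≡ ± x`
modulo `π ^ (r - v)`. -/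
lemma exists_sign_of_pow_dvd_sq_sub_sq {R : Type*} [CommRing R] [IsDomain R] {π a x : R}
    (hπ : Prime π) {r v : ℕ} (hx : ¬ π ^ (v + 1) ∣ 2 * x) (h : π ^ r ∣ a ^ 2 - x ^ 2) :
    ∃ ε : ℤˣ, π ^ (r - v) ∣ a - ((ε : ℤ) : R) * x := by
  -- The sign is that of the congruence left once the factor of small valuation is discarded: `+1`
  -- if that factor is `a + x`, and `-1` if it is `a - x`.
  by_cases hm : π ^ (v + 1) ∣ a - x
  · have hp : ¬ π ^ (v + 1) ∣ a + x := fun hp => hx <| by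
      have := dvd_sub hp hm
      rwa [show a + x - (a - x) = 2 * x by ring] at this
    refine ⟨1, ?_⟩
    simpa using hπ.pow_sub_dvd_of_pow_dvd_mul hp (by convert h using 1; ring)
  · refine ⟨-1, ?_⟩
    have := hπ.pow_sub_dvd_of_pow_dvd_mul hm (b := a + x) (by convert h using 1; ring)
    simpa using this

/-! ### Valuation theory of the ring of integers of a `p`-adic field -/

section PadicRingOfIntegers

variable {p : ℕ} [Fact p.Prime] {K : Type*} [Field K] [Algebra ℚ_[p] K]

instance : IsDomain (PadicRingOfIntegers p K) :=
  inferInstanceAs (IsDomain (integralClosure (PadicInt.subring p) K))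

/-- The spectral norm of `x` is read off the coefficients of its minimal polynomial over `ℚ_p`. It
is at most 1 exactly when all of them lie in `ℤ_p`, and the minimal polynomial is then itself a
monic integral equation for `x`. -/
lemma isIntegral_of_spectralNorm_le_one [FiniteDimensional ℚ_[p] K] {x : K}
    (hx : spectralNorm ℚ_[p] K x ≤ 1) : IsIntegral (PadicInt.subring p) x := by
  have hmon : (minpoly ℚ_[p] x).Monic := minpoly.monic (Algebra.IsIntegral.isIntegral x)
  have hc := (spectralValue_le_one_iff hmon).mp hx
  have hsub : ((minpoly ℚ_[p] x).coeffs : Set ℚ_[p]) ⊆ PadicInt.subring p := fun c hc' => by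
    obtain ⟨n, -, rfl⟩ := Polynomial.mem_coeffs_iff.mp hc'
    exact hc n
  refine ⟨(minpoly ℚ_[p] x).toSubring _ hsub, (Polynomial.monic_toSubring _ _ _).mpr hmon, ?_⟩
  have h := minpoly.aeval ℚ_[p] x
  rw [← Polynomial.map_toSubring _ _ hsub, Polynomial.aeval_def, Polynomial.eval₂_map] at h
  exact h

/-- The ring of integers of a finite extension of `ℚ_p` is a valuation ring, since the spectral
norm is multiplicative. -/
instance [FiniteDimensional ℚ_[p] K] : ValuationRing (PadicRingOfIntegers p K) := by
  have key (x : K) : IsIntegral (PadicInt.subring p) x ∨ IsIntegral (PadicInt.subring p) x⁻¹ := by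
    rcases le_total (spectralNorm ℚ_[p] K x) 1 with h | h
    · exact .inl (isIntegral_of_spectralNorm_le_one h)
    · refine .inr (isIntegral_of_spectralNorm_le_one ?_)
      have hinv : spectralNorm ℚ_[p] K x⁻¹ = (spectralNorm ℚ_[p] K x)⁻¹ :=
        map_inv₀ (spectralMulAlgNorm ℚ_[p] K) x
      rw [hinv]
      exact inv_le_one_of_one_le₀ h
  refine { cond' := fun a b => ?_ }
  by_cases hb : b = 0
  · exact ⟨0, .inl (by simp [hb])⟩
  by_cases ha : a = 0
  · exact ⟨0, .inr (by simp [ha])⟩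
  have ha' : a.1 ≠ 0 := fun h => ha (Subtype.ext h)
  have hb' : b.1 ≠ 0 := fun h => hb (Subtype.ext h)
  -- Either `b / a` or its inverse `a / b` is integral, and it serves as the cofactor.
  rcases key (b.1 / a.1) with h | h
  · exact ⟨⟨_, h⟩, .inl (Subtype.ext (mul_div_cancel₀ b.1 ha'))⟩
  · rw [inv_div] at h
    exact ⟨⟨_, h⟩, .inr (Subtype.ext (mul_div_cancel₀ a.1 hb'))⟩

/-- A valuation ring is Bézout, hence a GCD domain, where irreducible elements are prime. -/
lemma PadicRingOfIntegers.prime_of_irreducible [FiniteDimensional ℚ_[p] K]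
    {π : PadicRingOfIntegers p K} (hπ : Irreducible π) : Prime π :=
  letI := Classical.decEq (PadicRingOfIntegers p K)
  letI := IsBezout.toGCDDomain (PadicRingOfIntegers p K)
  hπ.prime

/-- Such an `n` has norm 1 in `ℤ_p`, so it is already invertible there. -/
lemma PadicRingOfIntegers.isUnit_natCast {n : ℕ} (hn : ¬ p ∣ n) :
    IsUnit (n : PadicRingOfIntegers p K) := by
  have h : ‖(n : ℤ_[p])‖ = 1 := by
    rw [PadicInt.norm_natCast_eq_one_iff]
    exact (Nat.Prime.coprime_iff_not_dvd Fact.out).mpr hn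
  have hu : IsUnit (n : ℤ_[p]) := PadicInt.isUnit_iff.mpr h
  have := hu.map (algebraMap (PadicInt.subring p) (integralClosure (PadicInt.subring p) K))
  exact (map_natCast (algebraMap (PadicInt.subring p) (integralClosure (PadicInt.subring p) K)) n)
    ▸ this

end PadicRingOfIntegers

lemma isUnit_halfPow {R : Type*} [CommRing R] {k l : ℕ} {s : R} (hl : IsUnit (l : R))
    (hs : Odd k → s ^ 2 = l) : IsUnit (halfPow k l s) := by
  rw [halfPow]
  split_ifs with h
  · exact hl.pow _
  · refine IsUnit.pow _ ((isUnit_pow_iff two_ne_zero).mp ?_)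
    rwa [hs (Nat.not_even_iff_odd.mp h)]

/-! ### Level raising conditions as divisibilities in 𝒪_K -/

section HeckeAlgebra

variable {p : ℕ} [Fact p.Prime] {K : Type*} [Field K] [Algebra ℚ_[p] K] [Algebra K ℂ]
  {N : ℕ} [NeZero N] {k : ℕ} {χ : DirichletCharacter (PadicRingOfIntegers p K) N}
  {π : PadicRingOfIntegers p K} {r : ℕ} {l : ℕ} {a ζ s : PadicRingOfIntegers p K}

/-- One lift `a` serves `f` and all its reductions, so the conditions on `f` and on `f_s` differ
only in the exponent of `π`. -/
lemma EigenformMod.reduce_apply_eq_mk {f : EigenformMod k χ π r} {T : HeckeAlgebra k χ}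
    (ha : f T = Ideal.Quotient.mk _ a) {t : ℕ} (h : t ≤ r) :
    EigenformMod.reduce f h T = Ideal.Quotient.mk _ a := by
  show Ideal.Quotient.factor (Ideal.span_singleton_le_span_singleton.mpr (pow_dvd_pow π h))
    (f T) = _
  rw [ha, Ideal.Quotient.factor_mk]

/-- `R_l` is a scalar, so `f` sends it to its class modulo `π ^ r`; only `T_l` requires a lift. -/
lemma lrc_iff {f : EigenformMod k χ π r} (hl : 1 ≤ l)
    (ha : f (heckeT k χ l hl) = Ideal.Quotient.mk _ a) (ε : ℤˣ) :
    LRC f l hl ζ s ε ↔ π ^ r ∣ a - ((ε : ℤ) : PadicRingOfIntegers p K) *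
      (((l : PadicRingOfIntegers p K) + 1) * (halfPow k l s * ζ)) := by
  rw [← Ideal.mem_span_singleton, ← Ideal.Quotient.eq_zero_iff_mem, LRC, RingHom.mem_ker, heckeR,
    map_sub, map_mul, map_mul, map_add, map_one, map_intCast, map_natCast, ha, AlgHom.commutes]
  simp only [map_sub, map_mul, map_add, map_one, map_intCast, map_natCast, mul_assoc]
  rfl

/-- Replacing `S_l` by `R_l ^ 2` turns the condition into one on a difference of two squares. -/
lemma lrcsq_iff {f : EigenformMod k χ π r} (hk : 2 ≤ k) (hl : 1 ≤ l)
    (ha : f (heckeT k χ l hl) = Ideal.Quotient.mk _ a)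
    (hζ : ζ ^ 2 = χ (l : ZMod N)) (hs : Odd k → s ^ 2 = l) :
    LRCsq f l hl ↔ π ^ r ∣
      a ^ 2 - (((l : PadicRingOfIntegers p K) + 1) * (halfPow k l s * ζ)) ^ 2 := by
  rw [← Ideal.mem_span_singleton, ← Ideal.Quotient.eq_zero_iff_mem, LRCsq, RingHom.mem_ker,
    ← heckeR_sq k χ hk hζ hs, heckeR, map_sub, map_mul, map_pow, map_pow, map_pow, map_add,
    map_one, map_natCast, ha, AlgHom.commutes]
  simp only [map_sub, map_mul, map_add, map_one, map_natCast, map_pow, mul_pow]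
  rfl

end HeckeAlgebra

end LevelRaising

/-! ### The sign dichotomy -/

theorem mainTheorem3 {p : ℕ} [Fact p.Prime] (hp : p ≠ 2)
    {K : Type*} [Field K] [Algebra ℚ_[p] K] [FiniteDimensional ℚ_[p] K] [Algebra K ℂ]
    {N : ℕ} [NeZero N] {k : ℕ} (hk : 2 ≤ k)
    (χ : DirichletCharacter (LevelRaising.PadicRingOfIntegers p K) N)
    (π : LevelRaising.PadicRingOfIntegers p K) (hπ : Irreducible π) {r : ℕ} (hr : 1 ≤ r)
    (f : LevelRaising.EigenformMod k χ π r)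
    {l : ℕ} (hl : l.Prime) (hlpN : ¬ l ∣ p * N)
    (ζ : LevelRaising.PadicRingOfIntegers p K) (hζ : ζ ^ 2 = χ (l : ZMod N))
    (s : LevelRaising.PadicRingOfIntegers p K) (hs : Odd k → s ^ 2 = (l : LevelRaising.PadicRingOfIntegers p K))
    (v : ℕ) (hv : emultiplicity π ((l : LevelRaising.PadicRingOfIntegers p K) + 1) = v) :
    (LevelRaising.LRCsq f l hl.one_le →
      ∃ ε : ℤˣ, LevelRaising.LRC (LevelRaising.EigenformMod.reduce f (Nat.sub_le r v)) l hl.one_le ζ s ε) ∧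
    (v = 0 → (LevelRaising.LRCsq f l hl.one_le ↔ ∃ ε : ℤˣ, LevelRaising.LRC f l hl.one_le ζ s ε)) := by
  obtain ⟨a, ha⟩ := Ideal.Quotient.mk_surjective (f (LevelRaising.heckeT k χ l hl.one_le))
  have hπ' := LevelRaising.PadicRingOfIntegers.prime_of_irreducible hπ
  have hlu : IsUnit (l : LevelRaising.PadicRingOfIntegers p K) :=
    LevelRaising.PadicRingOfIntegers.isUnit_natCast fun h =>
      hlpN (((Nat.prime_dvd_prime_iff_eq Fact.out hl).mp h) ▸ dvd_mul_right p N)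
  have h2u : IsUnit (2 : LevelRaising.PadicRingOfIntegers p K) := by
    exact_mod_cast LevelRaising.PadicRingOfIntegers.isUnit_natCast (K := K) (n := 2) fun h =>
      hp ((Nat.prime_dvd_prime_iff_eq Fact.out Nat.prime_two).mp h)
  have hζu : IsUnit ζ := by
    refine (isUnit_pow_iff two_ne_zero).mp (hζ ▸ IsUnit.map χ ?_)
    exact (ZMod.isUnit_iff_coprime l N).mpr
      (hl.coprime_iff_not_dvd.mpr fun h => hlpN (h.mul_left p))
  have hRu := (LevelRaising.isUnit_halfPow hlu hs).mul hζu
  -- The unit factors `2` and `R_l` do not affect divisibility, which leaves `l + 1`, of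
  -- multiplicity exactly `v`.
  have hx : ¬ π ^ (v + 1) ∣ 2 * (((l : LevelRaising.PadicRingOfIntegers p K) + 1) *
      (LevelRaising.halfPow k l s * ζ)) := by
    rw [h2u.dvd_mul_left, hRu.dvd_mul_right, pow_dvd_iff_le_emultiplicity, hv]
    exact_mod_cast Nat.not_succ_le_self v
  have hmain : LevelRaising.LRCsq f l hl.one_le → ∃ ε : ℤˣ, LevelRaising.LRC
      (LevelRaising.EigenformMod.reduce f (Nat.sub_le r v)) l hl.one_le ζ s ε := by
    rw [LevelRaising.lrcsq_iff hk hl.one_le ha.symm hζ hs]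
    intro h
    -- Truncated subtraction makes `r - v` equal to `max(r - v, 0)`; for `v ≥ r` the divisibility is
    -- by `1`.
    obtain ⟨ε, hε⟩ := LevelRaising.exists_sign_of_pow_dvd_sq_sub_sq hπ' hx h
    exact ⟨ε, (LevelRaising.lrc_iff hl.one_le
      (LevelRaising.EigenformMod.reduce_apply_eq_mk ha.symm _) ε).mpr hε⟩
  refine ⟨hmain, fun hv0 => ⟨fun h => ?_, ?_⟩⟩
  · obtain ⟨ε, hε⟩ := hmain h
    -- The reduction modulo `π ^ (r - v)` and `f` have different types even when `v = 0`. Passing to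
    -- divisibility in 𝒪_K confines the change to an exponent.
    rw [LevelRaising.lrc_iff hl.one_le
      (LevelRaising.EigenformMod.reduce_apply_eq_mk ha.symm _), hv0, Nat.sub_zero] at hε
    exact ⟨ε, (LevelRaising.lrc_iff hl.one_le ha.symm ε).mpr hε⟩
  · rintro ⟨ε, hε⟩
    rw [LevelRaising.lrc_iff hl.one_le ha.symm] at hε
    rw [LevelRaising.lrcsq_iff hk hl.one_le ha.symm hζ hs]
    -- Multiplying `a - εx` by `a + εx` gives `a² - x²`, because `ε² = 1`.
    refine (hε.mul_right (a + ((ε : ℤ) : LevelRaising.PadicRingOfIntegers p K) *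
      (((l : LevelRaising.PadicRingOfIntegers p K) + 1) *
        (LevelRaising.halfPow k l s * ζ)))).trans (dvd_of_eq ?_)
    have hε2 : ((ε : ℤ) : LevelRaising.PadicRingOfIntegers p K) ^ 2 = 1 := by
      rw [← Int.cast_pow, ← Units.val_pow_eq_pow_val, Int.units_sq]; simp
    linear_combination (-((((l : LevelRaising.PadicRingOfIntegers p K) + 1) *
      (LevelRaising.halfPow k l s * ζ)) ^ 2)) * hε2
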